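/- Let $n$ be an even natural number and let $\mathcal A=\{1,\dots,n\}$ label $n$ qubits, with Hilbert space $\mathcal H_{\mathcal A}=(\mathbb C^2)^{\otimes n}$. For a density operator $\rho$ on $\mathcal H_{\mathcal A}$ and $J\subseteq\mathcal A$ let $\rho_J$ be the partial trace of $\rho$ over the qubits outside $J$, let $S_2(J)_\rho=1-\operatorname{Tr}\rho_J^2$ (so $S_2(\varnothing)_\rho=0$), and set $$C_2(J)_\rho=\sum_{v\in J}S_2(\{v\})_\rho-S_2(J)_\rho,\qquad I_2(\mathcal A)_\rho=\sum_{J\subseteq\mathcal A}(-1)^{|J|-1}S_2(J)_\rho .$$ For $\varepsilon\in\mathbb R$ let $G(\varepsilon)_\rho=\{\varnothing\ne J\subseteq\mathcal A : C_2(J)_\rho\le\varepsilon\}$, let $\widetilde\beta_k(\varepsilon)_\rho$ be the $k$-th reduced Betti number ($k\ge 0$) of $G(\varepsilon)_\rho$ with coefficients in $\mathbb Z_2$, and define the reduced integrated Euler characteristic $$\widetilde{\mathfrak X}_2(\varepsilon)_\rho=\sum_{k\ge0}(-1)^k\int_0^{\varepsilon}\widetilde\beta_k(t)_\rho\,dt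 .$$ Then for every density operator $\rho$ on $\mathcal H_{\mathcal A}$ each $G(\varepsilon)_\rho$ is an abstract simplicial complex, the limit $\widetilde{\mathfrak X}_2(\infty)_\rho=\lim_{\varepsilon\to\infty}\widetilde{\mathfrak X}_2(\varepsilon)_\rho$ exists, and $$\widetilde{\mathfrak X}_2(\infty)_\rho=I_2(\mathcal A)_\rho .$$ Moreover, $\widetilde{\mathfrak X}_2(\infty)$ is an entanglement monotone, i.e. it does not increase on average under local Kraus operations (in particular under LOCC, resolved into product Kraus operators): for every density operator $\rho$ and every finite family of product operators $K_i=K_{i,1}\otimes\dots\otimes K_{i,n}$, with $K_{i,j}$ a linear operator on $\mathbb C^2$ and $\sum_iK_i^\dagger K_i=1$, $$\sum_{i:\,p_i>0}p_i\,\widetilde{\mathfrak X}_2(\infty)_{\sigma_i}\le\widetilde{\mathfrak X}_2(\infty)_\rho,\qquad p_i=\operatorname{Tr}(K_i\rho K_i^\dagger),\quad \sigma_i=\frac{K_i\rho K_i^\dagger}{p_i}.$$ -/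

import Mathlib

open scoped ComplexOrder Matrix Topology

noncomputable section

namespace QubitPersistence

/-- Operators on the Hilbert space `(ℂ²)^{⊗ n}`, as matrices in the standard product basis, whose
elements are labelled by the bit strings `Fin n → Fin 2`. -/
abbrev Op (n : ℕ) : Type := Matrix (Fin n → Fin 2) (Fin n → Fin 2) ℂ

/-- Density operators: positive semidefinite with trace one. -/
def IsState {n : ℕ} (ρ : Op n) : Prop :=
  ρ.PosSemidef ∧ ρ.trace = 1

/-- The bit string on all qubits that is `a` on `J` and `c` on the complement of `J`. -/
def glue {n : ℕ} (J : Finset (Fin n)) (a : {i // i ∈ J} → Fin 2) (c : {i // i ∉ J} → Fin 2) :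
    Fin n → Fin 2 :=
  fun i => if h : i ∈ J then a ⟨i, h⟩ else c ⟨i, h⟩

/-- The marginal `ρ_J`: the partial trace over all qubits outside `J`. -/
def marginal {n : ℕ} (ρ : Op n) (J : Finset (Fin n)) :
    Matrix ({i // i ∈ J} → Fin 2) ({i // i ∈ J} → Fin 2) ℂ :=
  Matrix.of fun a b => ∑ c : {i // i ∉ J} → Fin 2, ρ (glue J a c) (glue J b c)

/-- The linear entropy (Tsallis entropy with `q = 2`) `S₂(J)_ρ = 1 - Tr ρ_J²`. For a state and
`J = ∅` it is `0`, since then `ρ_J` is the `1 × 1` matrix with entry `Tr ρ = 1`. -/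
def linearEntropy {n : ℕ} (ρ : Op n) (J : Finset (Fin n)) : ℝ :=
  1 - (marginal ρ J * marginal ρ J).trace.re

/-- The deformed total correlation `C₂(J)_ρ = ∑_{v ∈ J} S₂(v)_ρ - S₂(J)_ρ`. -/
def totalCorrelation {n : ℕ} (ρ : Op n) (J : Finset (Fin n)) : ℝ :=
  ∑ v ∈ J, linearEntropy ρ {v} - linearEntropy ρ J

/-- The deformed interaction information `I₂(𝒜)_ρ = ∑_{J ⊆ 𝒜} (-1)^{|J|-1} S₂(J)_ρ`;
the sign is written `(-1)^{|J|+1}` to avoid truncated subtraction. -/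
def interactionInformation {n : ℕ} (ρ : Op n) : ℝ :=
  ∑ J : Finset (Fin n), (-1 : ℝ) ^ (J.card + 1) * linearEntropy ρ J

/-- The sublevel set `G(ε)_ρ` of the functional `C₂` on the nonempty sets of qubits. -/
def sublevelComplex {n : ℕ} (ρ : Op n) (ε : ℝ) : Set (Finset (Fin n)) :=
  {J | J.Nonempty ∧ totalCorrelation ρ J ≤ ε}

/-! ### Reduced simplicial homology with coefficients in `ZMod 2` -/

/-- The boundary operator of the augmented chain complex of the full simplex on `Fin n`: a set `J`
is sent to the sum of the sets `J \ {v}`, `v ∈ J` (signs do not matter modulo two). The empty set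
is the generator in degree `-1`, so that on `0`-chains this is the augmentation
`∑ σ_k ↦ (number of summands) mod 2`. -/
def boundary (n : ℕ) : (Finset (Fin n) → ZMod 2) →ₗ[ZMod 2] (Finset (Fin n) → ZMod 2) :=
  ∑ J : Finset (Fin n), (LinearMap.proj J).smulRight (∑ v ∈ J, Pi.single (J.erase v) 1)

/-- The `k`-chains of `G`: combinations of the members of `G` with `k + 1` vertices. -/
def chains {n : ℕ} (G : Set (Finset (Fin n))) (k : ℕ) :
    Submodule (ZMod 2) (Finset (Fin n) → ZMod 2) where
  carrier := {c | ∀ J, c J ≠ 0 → J ∈ G ∧ J.card = k + 1}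
  zero_mem' := fun J h => absurd rfl h
  add_mem' := by
    intro a b ha hb J h
    by_cases h0 : a J = 0
    · exact hb J fun h1 => h (by simp [h0, h1])
    · exact ha J h0
  smul_mem' := by
    intro r a ha J h
    exact ha J fun h1 => h (by simp [h1])

/-- The reduced `k`-cycles of `G`. -/
def cycles {n : ℕ} (G : Set (Finset (Fin n))) (k : ℕ) :
    Submodule (ZMod 2) (Finset (Fin n) → ZMod 2) :=
  chains G k ⊓ LinearMap.ker (boundary n)

/-- The `k`-boundaries of `G`. -/
def boundaries {n : ℕ} (G : Set (Finset (Fin n))) (k : ℕ) :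
    Submodule (ZMod 2) (Finset (Fin n) → ZMod 2) :=
  (chains G (k + 1)).map (boundary n)

/-- The reduced homology group of degree `k` of a simplicial complex `G` (a family of nonempty
sets that is closed under taking nonempty subsets): cycles modulo boundaries. -/
abbrev ReducedHomology {n : ℕ} (G : Set (Finset (Fin n))) (k : ℕ) : Type :=
  cycles G k ⧸ (boundaries G k).submoduleOf (cycles G k)

/-- The reduced Betti number of degree `k`. -/
def reducedBetti {n : ℕ} (G : Set (Finset (Fin n))) (k : ℕ) : ℕ :=
  Module.finrank (ZMod 2) (ReducedHomology G k)

/-! ### The topological summary -/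

/-- The reduced integrated Betti number of the persistence complex of `ρ`. -/
def reducedIntegratedBetti {n : ℕ} (ρ : Op n) (k : ℕ) (ε : ℝ) : ℝ :=
  ∫ t in (0 : ℝ)..ε, (reducedBetti (sublevelComplex ρ t) k : ℝ)

/-- The reduced integrated Euler characteristic of the persistence complex of `ρ`. (Only the terms
with `k < n` can be nonzero.) -/
def reducedIEC {n : ℕ} (ρ : Op n) (ε : ℝ) : ℝ :=
  ∑' k : ℕ, (-1 : ℝ) ^ k * reducedIntegratedBetti ρ k ε

/-- The value at infinity of the reduced integrated Euler characteristic. -/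
def reducedIECInfty {n : ℕ} (ρ : Op n) : ℝ :=
  Filter.limUnder Filter.atTop (reducedIEC ρ)

/-! ### Local operations and monotones -/

/-- The tensor product `K_1 ⊗ ⋯ ⊗ K_n` of operators on the individual qubits. -/
def localOp {n : ℕ} (K : Fin n → Matrix (Fin 2) (Fin 2) ℂ) : Op n :=
  Matrix.of fun a b => ∏ j, K j (a j) (b j)

/-- The probability `p = Tr(K ρ K†)` of the outcome with Kraus operator `K`. -/
def outcomeProb {n : ℕ} (K ρ : Op n) : ℝ :=
  (K * ρ * Kᴴ).trace.re

/-- The post-measurement state `K ρ K† / Tr(K ρ K†)`. -/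
def postState {n : ℕ} (K ρ : Op n) : Op n :=
  ((outcomeProb K ρ)⁻¹ : ℂ) • (K * ρ * Kᴴ)

/-- `T` is an entanglement monotone: it does not increase on average under any operation given by
finitely many local Kraus operators `K_i = ⨂_j K_{i,j}` with `∑_i K_i† K_i = 1`. An outcome of
probability zero contributes `0` to the average. -/
def IsEntanglementMonotone {n : ℕ} (T : Op n → ℝ) : Prop :=
  ∀ ρ : Op n, IsState ρ →
    ∀ (m : ℕ) (K : Fin m → Fin n → Matrix (Fin 2) (Fin 2) ℂ),
      ∑ i, (localOp (K i))ᴴ * localOp (K i) = 1 →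
        ∑ i, outcomeProb (localOp (K i)) ρ * T (postState (localOp (K i)) ρ) ≤ T ρ

end QubitPersistence

end

/-!
Let `F_J` be the operator on two copies of the qubits that swaps the copies of those in `J`, so
that `Tr ρ_J² = Tr (ρ ⊗ ρ) F_J`. For disjoint `A` and `B` the operators `1 - F_A` and `1 - F_B` are
positive and commute, and `F_A F_B = F_{A ∪ B}`; positivity of their product makes `C₂` monotone
in `J`. Thus the `G(ε)` are a filtration by simplicial complexes, and integrating the
Euler–Poincaré formula gives `∑_J (-1)^|J| C₂(J)`, which is `I₂` since the one-qubit terms cancel.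

On each qubit `1 - F` is `|s⟩⟨s|` for the unnormalized singlet `s`, so `∑_J (-1)^|J| F_J` is the
rank-one operator of a tensor power of singlets and `I₂` is, up to a constant, `Tr ρ ρ̃` with `ρ̃`
the spin flip of `ρ`. For a product operator `K` the spin flip `K̃` is the tensor product of the
adjugates, hence `K̃ K = d` is a scalar and `K` multiplies `Tr ρ ρ̃` by `|d|²`. By Cauchy–Schwarz
`|d|² ≤ Tr(K ρ K†) Tr(K̃† ρ K̃)`, and the operators `K̃ᵢ†` again form a complete Kraus family.
-/

namespace QubitPersistence

open scoped Kronecker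

section PositiveSemidefinite

variable {𝕜 m : Type*} [RCLike 𝕜] [Fintype m]

open scoped MatrixOrder Matrix.Norms.L2Operator in
theorem trace_mul_nonneg {A B : Matrix m m 𝕜} (hA : A.PosSemidef) (hB : B.PosSemidef) :
    0 ≤ (A * B).trace := by
  classical
  obtain ⟨C, rfl⟩ := CStarAlgebra.nonneg_iff_eq_star_mul_self.mp hB.nonneg
  rw [← Matrix.mul_assoc, Matrix.trace_mul_comm, ← Matrix.mul_assoc]
  exact (hA.mul_mul_conjTranspose_same C).trace_nonneg

theorem posSemidef_one_sub_of_mul_self_eq_one [DecidableEq m] {U : Matrix m m 𝕜}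
    (hU : U.IsHermitian) (hUU : U * U = 1) : (1 - U).PosSemidef := by
  have hsq : (1 - U) = (2⁻¹ : ℝ) • ((1 - U)ᴴ * (1 - U)) := by
    have : (1 - U) * (1 - U) = (2 : ℝ) • (1 - U) := by
      rw [Matrix.mul_sub, Matrix.sub_mul, Matrix.sub_mul, hUU, two_smul]
      simp only [Matrix.one_mul, Matrix.mul_one]
      abel
    rw [Matrix.conjTranspose_sub, Matrix.conjTranspose_one, hU.eq, this,
      inv_smul_smul₀ two_ne_zero]
  rw [hsq]
  exact (Matrix.posSemidef_conjTranspose_mul_self _).smul (by norm_num)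

open scoped MatrixOrder Matrix.Norms.L2Operator in
theorem posSemidef_mul_of_commute {A B : Matrix m m 𝕜} (hA : A.PosSemidef) (hB : B.PosSemidef)
    (h : Commute A B) : (A * B).PosSemidef := by
  classical
  exact Matrix.nonneg_iff_posSemidef.mp (Commute.mul_nonneg hA.nonneg hB.nonneg h)

theorem norm_trace_mul_mul_conjTranspose_sq_le {R : Matrix m m 𝕜} (hR : R.PosSemidef)
    (A B : Matrix m m 𝕜) :
    ‖(A * R * Bᴴ).trace‖ ^ 2 ≤
      RCLike.re (A * R * Aᴴ).trace * RCLike.re (B * R * Bᴴ).trace := by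
  let := R.toMatrixSeminormedAddCommGroup hR
  let := R.toMatrixInnerProductSpace hR
  have h := inner_mul_inner_self_le (𝕜 := 𝕜) A B
  rw [norm_inner_symm A B, ← sq] at h
  exact h

end PositiveSemidefinite

section PartialSwap

variable {ι α : Type*} [DecidableEq ι]

/-- The exchange of the entries in `J` of two families indexed by `ι`. -/
def partialSwap (J : Finset ι) : Equiv.Perm ((ι → α) × (ι → α)) :=
  Function.Involutive.toPerm (fun p => (J.piecewise p.2 p.1, J.piecewise p.1 p.2)) fun p => by
    ext i <;> by_cases h : i ∈ J <;> simp [h]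

theorem partialSwap_apply (J : Finset ι) (p : (ι → α) × (ι → α)) :
    partialSwap J p = (J.piecewise p.2 p.1, J.piecewise p.1 p.2) := rfl

theorem partialSwap_mul_self (J : Finset ι) :
    partialSwap (α := α) J * partialSwap J = 1 :=
  Equiv.ext (partialSwap J).left_inv

theorem partialSwap_mul_of_disjoint {A B : Finset ι} (h : Disjoint A B) :
    partialSwap (α := α) A * partialSwap B = partialSwap (A ∪ B) := by
  have hAB : ∀ i ∈ A, i ∉ B := fun i hi => Finset.disjoint_left.mp h hi
  ext p i <;>
    simp only [Equiv.Perm.mul_apply, partialSwap_apply, Finset.piecewise, Finset.mem_union] <;>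
    grind

end PartialSwap

section AlternatingSums

variable {V R : Type*} [Fintype V] [CommRing R]

theorem sum_neg_one_pow_card_mul_eq_zero [DecidableEq V] (w : V) {g : Finset V → R}
    (hg : ∀ J, w ∉ J → g (insert w J) = g J) : ∑ J : Finset V, (-1) ^ J.card * g J = 0 := by
  have huniv : (Finset.univ : Finset (Finset V)) = (insert w (Finset.univ.erase w)).powerset := by
    rw [Finset.insert_erase (Finset.mem_univ w), Finset.powerset_univ]
  rw [huniv, Finset.sum_powerset_insert (Finset.notMem_erase w _), ← Finset.sum_add_distrib]
  refine Finset.sum_eq_zero fun J hJ => ?_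
  have hw : w ∉ J := fun h => Finset.notMem_erase w _ (Finset.mem_powerset.mp hJ h)
  rw [Finset.card_insert_of_notMem hw, hg J hw]
  ring

theorem sum_neg_one_pow_card_eq_zero [Nonempty V] : ∑ J : Finset V, (-1 : R) ^ J.card = 0 := by
  have h := Finset.sum_powerset_neg_one_pow_card_of_nonempty (Finset.univ_nonempty (α := V))
  rw [Finset.powerset_univ] at h
  exact_mod_cast congrArg (Int.cast : ℤ → R) h

theorem sum_neg_one_pow_card_mul_sum_eq_zero (hV : Fintype.card V ≠ 1) (f : V → R) :
    ∑ J : Finset V, (-1) ^ J.card * ∑ v ∈ J, f v = 0 := by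
  classical
  have hcount : ∀ J : Finset V, ∑ v ∈ J, f v = ∑ v, if v ∈ J then f v else 0 := by simp
  simp_rw [hcount, Finset.mul_sum]
  rw [Finset.sum_comm]
  refine Finset.sum_eq_zero fun v _ => ?_
  have : Nontrivial V :=
    Fintype.one_lt_card_iff_nontrivial.mp (lt_of_le_of_ne (Fintype.card_pos_iff.mpr ⟨v⟩) hV.symm)
  obtain ⟨w, hwv⟩ := exists_ne v
  exact sum_neg_one_pow_card_mul_eq_zero w fun J _ => by
    simp only [Finset.mem_insert, hwv.symm, false_or]

end AlternatingSums

section IndicatorIntegral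

variable {E : Type*} [NormedAddCommGroup E]

theorem intervalIntegrable_indicator_Ici (c : ℝ) (r : E) (a b : ℝ) :
    IntervalIntegrable ((Set.Ici c).indicator fun _ => r) MeasureTheory.volume a b :=
  ⟨intervalIntegrable_const.1.indicator measurableSet_Ici,
    intervalIntegrable_const.2.indicator measurableSet_Ici⟩

theorem integral_indicator_Ici [NormedSpace ℝ E] [CompleteSpace E] {a b c : ℝ} (hac : a ≤ c)
    (hcb : c ≤ b) (r : E) :
    ∫ t in a..b, (Set.Ici c).indicator (fun _ => r) t = (b - c) • r := by
  have hleft : ∫ t in a..c, (Set.Ici c).indicator (fun _ => r) t = ∫ _ in a..c, (0 : E) :=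
    intervalIntegral.integral_congr_uIoo fun t ht => Set.indicator_of_notMem
      (not_le.mpr (Set.uIoo_of_le hac ▸ ht).2) _
  have hright : ∫ t in c..b, (Set.Ici c).indicator (fun _ => r) t = ∫ _ in c..b, r :=
    intervalIntegral.integral_congr fun t ht => Set.indicator_of_mem
      (Set.uIcc_of_le hcb ▸ ht).1 _
  rw [← intervalIntegral.integral_add_adjacent_intervals
    (intervalIntegrable_indicator_Ici c r a c) (intervalIntegrable_indicator_Ici c r c b),
    hleft, hright, intervalIntegral.integral_zero, zero_add, intervalIntegral.integral_const]

end IndicatorIntegral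

section Purity

variable {n : ℕ} {ρ : Op n}

/-- The purity `Tr ρ_J²` of the marginal on `J`. -/
def purity (ρ : Op n) (J : Finset (Fin n)) : ℂ :=
  (marginal ρ J * marginal ρ J).trace

theorem linearEntropy_eq (ρ : Op n) (J : Finset (Fin n)) :
    linearEntropy ρ J = 1 - (purity ρ J).re := rfl

theorem piecewise_glue_glue (J : Finset (Fin n)) (a b : {i // i ∈ J} → Fin 2)
    (c d : {i // i ∉ J} → Fin 2) : J.piecewise (glue J b d) (glue J a c) = glue J b c := by
  ext i
  by_cases h : i ∈ J <;> simp [glue, h]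

theorem sum_glue {M : Type*} [AddCommMonoid M] (J : Finset (Fin n)) (f : (Fin n → Fin 2) → M) :
    ∑ a, ∑ c, f (glue J a c) = ∑ x, f x := by
  rw [← Fintype.sum_prod_type']
  exact (Equiv.piEquivPiSubtypeProd (· ∈ J) fun _ => Fin 2).symm.sum_comp f

theorem purity_eq_sum (ρ : Op n) (J : Finset (Fin n)) :
    purity ρ J = ∑ x, ∑ y, ρ x (J.piecewise y x) * ρ y (J.piecewise x y) := by
  simp only [← sum_glue J, piecewise_glue_glue, purity, Matrix.trace, Matrix.diag,
    Matrix.mul_apply, marginal, Matrix.of_apply, Finset.sum_mul_sum]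
  exact Finset.sum_congr rfl fun a _ => Finset.sum_comm

theorem purity_eq_trace_kronecker_mul_partialSwap (ρ : Op n) (J : Finset (Fin n)) :
    purity ρ J = ((ρ ⊗ₖ ρ) * (partialSwap J).permMatrix ℂ).trace := by
  rw [purity_eq_sum, ← Fintype.sum_prod_type', PEquiv.mul_toMatrix_toPEquiv]
  rfl

theorem purity_empty (ρ : Op n) : purity ρ ∅ = ρ.trace ^ 2 := by
  simp [purity_eq_sum, Matrix.trace, sq, Finset.sum_mul_sum]

theorem purity_add_purity_le (hρ : IsState ρ) {A B : Finset (Fin n)} (h : Disjoint A B) :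
    purity ρ A + purity ρ B ≤ 1 + purity ρ (A ∪ B) := by
  let W (J : Finset (Fin n)) := (partialSwap (α := Fin 2) J).permMatrix ℂ
  have hW (J) : (1 - W J).PosSemidef :=
    posSemidef_one_sub_of_mul_self_eq_one (Matrix.conjTranspose_permMatrix (partialSwap J))
      (by rw [← Matrix.permMatrix_mul, partialSwap_mul_self, Matrix.permMatrix_one])
  have hAB : W A * W B = W (A ∪ B) := by
    rw [← Matrix.permMatrix_mul, partialSwap_mul_of_disjoint h.symm, Finset.union_comm]
  have hBA : W B * W A = W (A ∪ B) := by
    rw [← Matrix.permMatrix_mul, partialSwap_mul_of_disjoint h]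
  have hcomm : Commute (1 - W A) (1 - W B) :=
    (Commute.one_left _).sub_left ((Commute.one_right _).sub_right (hAB.trans hBA.symm))
  have key := trace_mul_nonneg (hρ.1.kronecker hρ.1)
    (posSemidef_mul_of_commute (hW A) (hW B) hcomm)
  have hexp : (1 - W A) * (1 - W B) = 1 + W (A ∪ B) - (W A + W B) := by
    rw [← hAB]
    noncomm_ring
  rw [hexp, Matrix.mul_sub, Matrix.mul_add, Matrix.mul_add, Matrix.mul_one, Matrix.trace_sub,
    Matrix.trace_add, Matrix.trace_add, Matrix.trace_kronecker, hρ.2, one_mul] at key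
  simpa only [purity_eq_trace_kronecker_mul_partialSwap] using sub_nonneg.mp key

theorem totalCorrelation_mono (hρ : IsState ρ) : Monotone (totalCorrelation ρ) := by
  rw [Finset.monotone_iff_forall_le_insert]
  intro A v hv
  have h := (Complex.le_def.mp (purity_add_purity_le hρ (Finset.disjoint_singleton_left.mpr hv))).1
  simp only [← Finset.insert_eq, Complex.add_re, Complex.one_re] at h
  simp only [totalCorrelation, linearEntropy_eq, Finset.sum_insert hv]
  linarith

theorem totalCorrelation_empty (hρ : IsState ρ) : totalCorrelation ρ ∅ = 0 := by
  simp [totalCorrelation, linearEntropy_eq, purity_empty, hρ.2]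

theorem totalCorrelation_singleton (ρ : Op n) (v : Fin n) : totalCorrelation ρ {v} = 0 := by
  simp [totalCorrelation]

end Purity

section Homology

variable {R : Type*} [CommRing R] {n k : ℕ} {G H : Set (Finset (Fin n))}

theorem boundary_single (J : Finset (Fin n)) :
    boundary n (Pi.single J 1) = ∑ v ∈ J, Pi.single (J.erase v) 1 := by
  simp [boundary, Pi.single_apply, ite_smul]

theorem boundary_comp_boundary : boundary n ∘ₗ boundary n = 0 := by
  refine (Pi.basisFun (ZMod 2) (Finset (Fin n))).ext fun J => ?_
  simp only [Pi.basisFun_apply, LinearMap.comp_apply, boundary_single, map_sum,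
    LinearMap.zero_apply]
  rw [Finset.sum_sigma']
  -- The terms `(J \ {v}) \ {w}` and `(J \ {w}) \ {v}` cancel modulo two.
  refine Finset.sum_involution (fun p _ => ⟨p.2, p.1⟩) ?_ ?_ ?_ fun _ _ => rfl
  · rintro ⟨v, w⟩ _
    simp only [Finset.erase_right_comm (a := w) (b := v)]
    exact CharTwo.add_self_eq_zero _
  all_goals simp only [Finset.mem_sigma, Finset.mem_erase, ne_eq]; grind

theorem chains_mono (h : G ⊆ H) (k : ℕ) : chains G k ≤ chains H k :=
  fun _ hc J hJ => ⟨h (hc J hJ).1, (hc J hJ).2⟩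

theorem chains_eq_span (G : Set (Finset (Fin n))) (k : ℕ) :
    chains G k =
      Submodule.span (ZMod 2) ((fun J => Pi.single J 1) '' {J | J ∈ G ∧ J.card = k + 1}) := by
  ext c
  rw [← funext (Pi.basisFun_apply (ZMod 2) (Finset (Fin n))), Module.Basis.mem_span_image]
  simp [chains, Set.subset_def]

theorem chains_eq_bot (G : Set (Finset (Fin n))) (hk : n ≤ k) : chains G k = ⊥ := by
  have h : {J | J ∈ G ∧ J.card = k + 1} = ∅ := Set.eq_empty_of_forall_notMem fun J hJ => by
    have := card_finset_fin_le J
    have := hJ.2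
    omega
  rw [chains_eq_span, h, Set.image_empty, Submodule.span_empty]

theorem boundaries_le_chains (hG : IsRelLowerSet G Finset.Nonempty) (k : ℕ) :
    boundaries G k ≤ chains G k := by
  rw [boundaries, chains_eq_span, Submodule.map_span_le]
  rintro _ ⟨J, ⟨hJG, hJ⟩, rfl⟩
  rw [boundary_single, chains_eq_span]
  refine Submodule.sum_mem _ fun v hv => Submodule.subset_span ⟨J.erase v, ?_, rfl⟩
  have hcard : (J.erase v).card = k + 1 := by rw [Finset.card_erase_of_mem hv, hJ]; rfl
  exact ⟨(hG hJG).2 (Finset.erase_subset v J) (Finset.card_pos.mp (by omega)), hcard⟩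

theorem boundaries_le_cycles (hG : IsRelLowerSet G Finset.Nonempty) (k : ℕ) :
    boundaries G k ≤ cycles G k := by
  refine le_inf (boundaries_le_chains hG k) ?_
  rintro _ ⟨c, -, rfl⟩
  exact LinearMap.congr_fun boundary_comp_boundary c

/-- The rank of the boundary operator on the `k`-chains of `G`. -/
noncomputable def boundaryRank (G : Set (Finset (Fin n))) (k : ℕ) : ℕ :=
  Module.finrank (ZMod 2) ((chains G k).map (boundary n))

theorem boundaryRank_mono (h : G ⊆ H) (k : ℕ) : boundaryRank G k ≤ boundaryRank H k :=
  Submodule.finrank_mono (Submodule.map_mono (chains_mono h k))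

theorem finrank_cycles_add_boundaryRank (G : Set (Finset (Fin n))) (k : ℕ) :
    Module.finrank (ZMod 2) (cycles G k) + boundaryRank G k =
      Module.finrank (ZMod 2) (chains G k) := by
  rw [← LinearMap.finrank_range_add_finrank_ker ((boundary n).domRestrict (chains G k)),
    LinearMap.range_domRestrict, LinearMap.ker_domRestrict, add_comm, boundaryRank, cycles]
  congr 1
  rw [← Submodule.finrank_map_subtype_eq (chains G k), Submodule.map_comap_subtype]

theorem reducedBetti_add_boundaryRank (hG : IsRelLowerSet G Finset.Nonempty) (k : ℕ) :
    reducedBetti G k + (boundaryRank G k + boundaryRank G (k + 1)) =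
      Module.finrank (ZMod 2) (chains G k) := by
  have hquot : reducedBetti G k + _ = _ :=
    Submodule.finrank_quotient_add_finrank ((boundaries G k).submoduleOf (cycles G k))
  have hbound : Module.finrank (ZMod 2) ((boundaries G k).submoduleOf (cycles G k)) =
      boundaryRank G (k + 1) :=
    (Submodule.submoduleOfEquivOfLe (boundaries_le_cycles hG k)).finrank_eq
  have hcycles := finrank_cycles_add_boundaryRank G k
  omega

theorem boundaryRank_zero (hG : IsRelLowerSet G Finset.Nonempty) (hne : G.Nonempty) :
    boundaryRank G 0 = 1 := by
  have himage : boundary n '' ((fun J => Pi.single J 1) '' {J | J ∈ G ∧ J.card = 0 + 1}) =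
      {Pi.single ∅ 1} := by
    obtain ⟨J, hJ⟩ := hne
    obtain ⟨v, hv⟩ := (hG hJ).1
    have hvG : {v} ∈ G :=
      (hG hJ).2 (Finset.singleton_subset_iff.mpr hv) (Finset.singleton_nonempty v)
    refine Set.eq_singleton_iff_unique_mem.mpr
      ⟨⟨_, ⟨{v}, ⟨hvG, rfl⟩, rfl⟩, by simp [boundary_single]⟩, ?_⟩
    rintro _ ⟨_, ⟨I, ⟨-, hI⟩, rfl⟩, rfl⟩
    obtain ⟨w, rfl⟩ := Finset.card_eq_one.mp hI
    simp [boundary_single]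
  rw [boundaryRank, chains_eq_span, Submodule.map_span, himage, finrank_span_singleton]
  simp [Pi.single_eq_zero_iff]

theorem boundaryRank_eq_zero (G : Set (Finset (Fin n))) (hk : n ≤ k) : boundaryRank G k = 0 := by
  rw [boundaryRank, chains_eq_bot G hk, Submodule.map_bot, finrank_bot]

theorem reducedBetti_eq_zero (G : Set (Finset (Fin n))) (hk : n ≤ k) : reducedBetti G k = 0 := by
  have hcycles : Module.finrank (ZMod 2) (cycles G k) = 0 := by
    have := finrank_cycles_add_boundaryRank G k
    rw [chains_eq_bot G hk, finrank_bot] at this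
    omega
  exact Nat.eq_zero_of_le_zero ((Submodule.finrank_quotient_le _).trans hcycles.le)

open Classical in
theorem finrank_chains (G : Set (Finset (Fin n))) (k : ℕ) :
    Module.finrank (ZMod 2) (chains G k) =
      (Finset.univ.filter fun J => J ∈ G ∧ J.card = k + 1).card := by
  have hindep := (Pi.basisFun (ZMod 2) (Finset (Fin n))).linearIndependent.comp
    (fun J : {J // J ∈ G ∧ J.card = k + 1} => J.1) Subtype.val_injective
  have h := finrank_span_eq_card hindep
  rw [Set.range_comp, Subtype.range_coe_subtype, Fintype.card_subtype] at h
  rw [chains_eq_span, ← h, ← funext (Pi.basisFun_apply (ZMod 2) (Finset (Fin n)))]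

open Classical in
theorem sum_neg_one_pow_mul_finrank_chains (hG : IsRelLowerSet G Finset.Nonempty) :
    ∑ k ∈ Finset.range n, (-1 : R) ^ k * Module.finrank (ZMod 2) (chains G k) =
      -∑ J with J ∈ G, (-1 : R) ^ J.card := by
  have hmaps : ∀ J ∈ Finset.univ.filter (· ∈ G), J.card - 1 ∈ Finset.range n := fun J hJ => by
    have := Finset.card_pos.mpr (hG (Finset.mem_filter.mp hJ).2).1
    have := card_finset_fin_le J
    exact Finset.mem_range.mpr (by omega)
  rw [← Finset.sum_fiberwise_of_maps_to hmaps, ← Finset.sum_neg_distrib]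
  refine Finset.sum_congr rfl fun k _ => ?_
  have hfiber : Finset.univ.filter (fun J => J ∈ G ∧ J.card = k + 1) =
      (Finset.univ.filter (· ∈ G)).filter (fun J => J.card - 1 = k) := by
    ext J
    have : J ∈ G → 0 < J.card := fun hJ => Finset.card_pos.mpr (hG hJ).1
    simp only [Finset.mem_filter, Finset.mem_univ, true_and]
    grind
  rw [finrank_chains, ← hfiber, Finset.sum_congr rfl (g := fun _ => -(-1 : R) ^ k)]
  · simp [mul_comm]
  · intro J hJ
    rw [(Finset.mem_filter.mp hJ).2.2, pow_succ, mul_neg_one]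

theorem sum_neg_one_pow_mul_boundaryRank (hG : IsRelLowerSet G Finset.Nonempty) (hne : G.Nonempty) :
    ∑ k ∈ Finset.range n, (-1 : R) ^ k * (boundaryRank G k + boundaryRank G (k + 1)) = 1 := by
  have htelescope := Finset.sum_range_sub' (fun k => (-1 : R) ^ k * boundaryRank G k) n
  rw [boundaryRank_zero hG hne, boundaryRank_eq_zero G le_rfl] at htelescope
  simpa [pow_succ, mul_add] using htelescope

open Classical in
theorem sum_neg_one_pow_mul_reducedBetti (hG : IsRelLowerSet G Finset.Nonempty) (hne : G.Nonempty) :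
    ∑ k ∈ Finset.range n, (-1 : R) ^ k * reducedBetti G k =
      -∑ J with J ∈ insert ∅ G, (-1 : R) ^ J.card := by
  have hbetti : ∀ k, (reducedBetti G k : R) = Module.finrank (ZMod 2) (chains G k) -
      (boundaryRank G k + boundaryRank G (k + 1)) := fun k => by
    rw [← reducedBetti_add_boundaryRank hG k]
    push_cast
    ring
  have hinsert : Finset.univ.filter (· ∈ insert ∅ G) = insert ∅ (Finset.univ.filter (· ∈ G)) := by
    ext J
    simp
  have hempty : ∅ ∉ Finset.univ.filter (· ∈ G) := fun h =>
    Finset.not_nonempty_empty (hG (Finset.mem_filter.mp h).2).1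
  simp_rw [hbetti, mul_sub, Finset.sum_sub_distrib]
  rw [sum_neg_one_pow_mul_finrank_chains hG, sum_neg_one_pow_mul_boundaryRank hG hne, hinsert,
    Finset.sum_insert hempty, Finset.card_empty, pow_zero]
  ring

end Homology

section SublevelFiltration

variable {n : ℕ}

theorem intervalIntegrable_reducedBetti {G : ℝ → Set (Finset (Fin n))} (hmono : Monotone G)
    (hG : ∀ t, IsRelLowerSet (G t) Finset.Nonempty) (k : ℕ) (a b : ℝ) :
    IntervalIntegrable (fun t => (reducedBetti (G t) k : ℝ)) MeasureTheory.volume a b := by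
  have hbetti : (fun t => (reducedBetti (G t) k : ℝ)) = fun t =>
      (Module.finrank (ZMod 2) (chains (G t) k) : ℝ) -
        (boundaryRank (G t) k + boundaryRank (G t) (k + 1)) := by
    funext t
    rw [← reducedBetti_add_boundaryRank (hG t) k]
    push_cast
    ring
  have hrank : ∀ j, Monotone fun t => (boundaryRank (G t) j : ℝ) :=
    fun j s t hst => Nat.cast_le.mpr (boundaryRank_mono (hmono hst) j)
  have hchains : Monotone fun t => (Module.finrank (ZMod 2) (chains (G t) k) : ℝ) :=
    fun s t hst => Nat.cast_le.mpr (Submodule.finrank_mono (chains_mono (hmono hst) k))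
  rw [hbetti]
  exact hchains.intervalIntegrable.sub
    ((hrank k).intervalIntegrable.add (hrank (k + 1)).intervalIntegrable)

theorem tsum_integral_reducedBetti {G : ℝ → Set (Finset (Fin n))} (hmono : Monotone G)
    (hG : ∀ t, IsRelLowerSet (G t) Finset.Nonempty) (a b : ℝ) :
    ∑' k : ℕ, (-1 : ℝ) ^ k * ∫ t in a..b, (reducedBetti (G t) k : ℝ) =
      ∫ t in a..b, ∑ k ∈ Finset.range n, (-1 : ℝ) ^ k * reducedBetti (G t) k := by
  rw [intervalIntegral.integral_finsetSum
    fun k _ => (intervalIntegrable_reducedBetti hmono hG k a b).const_mul _,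
    tsum_eq_sum (s := Finset.range n)]
  · simp_rw [intervalIntegral.integral_const_mul]
  · intro k hk
    rw [Finset.mem_range, not_lt] at hk
    simp [reducedBetti_eq_zero _ hk]

/-- The nonempty sets at which a set function is at most `t`: the filtration whose members for
`f = totalCorrelation ρ` are the complexes `sublevelComplex ρ t`. -/
def nonemptySublevel (f : Finset (Fin n) → ℝ) (t : ℝ) : Set (Finset (Fin n)) :=
  {J | J.Nonempty ∧ f J ≤ t}

variable {f : Finset (Fin n) → ℝ}

theorem nonemptySublevel_mono (f : Finset (Fin n) → ℝ) : Monotone (nonemptySublevel f) :=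
  fun _ _ hst _ hJ => ⟨hJ.1, hJ.2.trans hst⟩

theorem isRelLowerSet_nonemptySublevel (hf : Monotone f) (t : ℝ) :
    IsRelLowerSet (nonemptySublevel f t) Finset.Nonempty :=
  fun _ hJ => ⟨hJ.1, fun _ hI hne => ⟨hne, (hf hI).trans hJ.2⟩⟩

theorem sum_reducedBetti_nonemptySublevel [Nonempty (Fin n)] (hf : Monotone f) (hempty : f ∅ = 0)
    (hsingleton : ∀ v, f {v} = 0) {t : ℝ} (ht : 0 ≤ t) :
    ∑ k ∈ Finset.range n, (-1 : ℝ) ^ k * reducedBetti (nonemptySublevel f t) k =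
      -∑ J, (Set.Ici (f J)).indicator (fun _ => (-1) ^ J.card) t := by
  classical
  inhabit Fin n
  have hne : (nonemptySublevel f t).Nonempty :=
    ⟨{default}, Finset.singleton_nonempty _, (hsingleton _).trans_le ht⟩
  have hinsert : ∀ J, J ∈ insert ∅ (nonemptySublevel f t) ↔ f J ≤ t := fun J => by
    rcases J.eq_empty_or_nonempty with rfl | hJ
    · simp [hempty, ht]
    · simp [nonemptySublevel, hJ, hJ.ne_empty]
  rw [sum_neg_one_pow_mul_reducedBetti (isRelLowerSet_nonemptySublevel hf t) hne,
    Finset.sum_filter]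
  simp only [hinsert, Set.indicator_apply, Set.mem_Ici]

theorem integral_sum_reducedBetti_nonemptySublevel (hf : Monotone f) (hempty : f ∅ = 0)
    (hsingleton : ∀ v, f {v} = 0) {ε : ℝ} (hε : f Finset.univ ≤ ε) :
    ∫ t in (0 : ℝ)..ε, ∑ k ∈ Finset.range n, (-1 : ℝ) ^ k * reducedBetti (nonemptySublevel f t) k =
      ∑ J, (-1 : ℝ) ^ J.card * f J := by
  rcases n.eq_zero_or_pos with rfl | hn
  · have hf0 : f = 0 := funext fun J => (Finset.eq_empty_of_isEmpty J) ▸ hempty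
    simp [hf0]
  have : Nonempty (Fin n) := ⟨0, hn⟩
  have hf0 : ∀ J, 0 ≤ f J := fun J => hempty ▸ hf (Finset.empty_subset J)
  have hfε : ∀ J, f J ≤ ε := fun J => (hf (Finset.subset_univ J)).trans hε
  have hEuler : Set.EqOn
      (fun t => ∑ k ∈ Finset.range n, (-1 : ℝ) ^ k * reducedBetti (nonemptySublevel f t) k)
      (fun t => -∑ J, (Set.Ici (f J)).indicator (fun _ => (-1) ^ J.card) t) (Set.uIcc 0 ε) :=
    fun t ht => sum_reducedBetti_nonemptySublevel hf hempty hsingleton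
      ((Set.uIcc_of_le ((hf0 ∅).trans (hfε ∅))) ▸ ht).1
  calc ∫ t in (0 : ℝ)..ε, ∑ k ∈ Finset.range n,
          (-1 : ℝ) ^ k * reducedBetti (nonemptySublevel f t) k
      = -∑ J, (ε - f J) * (-1) ^ J.card := by
        rw [intervalIntegral.integral_congr hEuler, intervalIntegral.integral_neg,
          intervalIntegral.integral_finsetSum
            fun J _ => intervalIntegrable_indicator_Ici (f J) _ 0 ε]
        simp_rw [integral_indicator_Ici (hf0 _) (hfε _), smul_eq_mul]
    _ = ∑ J, (-1) ^ J.card * f J - ε * ∑ J : Finset (Fin n), (-1) ^ J.card := by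
        rw [Finset.mul_sum, ← Finset.sum_sub_distrib, ← Finset.sum_neg_distrib]
        exact Finset.sum_congr rfl fun J _ => by ring
    _ = ∑ J, (-1) ^ J.card * f J := by
        rw [sum_neg_one_pow_card_eq_zero, mul_zero, sub_zero]

end SublevelFiltration

section IntegratedEulerCharacteristic

variable {n : ℕ} {ρ : Op n}

theorem isRelLowerSet_sublevelComplex (hρ : IsState ρ) (ε : ℝ) :
    IsRelLowerSet (sublevelComplex ρ ε) Finset.Nonempty :=
  isRelLowerSet_nonemptySublevel (totalCorrelation_mono hρ) ε

theorem tendsto_reducedIEC (hρ : IsState ρ) :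
    Filter.Tendsto (reducedIEC ρ) Filter.atTop
      (𝓝 (∑ J, (-1) ^ J.card * totalCorrelation ρ J)) := by
  refine tendsto_const_nhds.congr' ?_
  filter_upwards [Filter.eventually_ge_atTop (totalCorrelation ρ Finset.univ)] with ε hε
  rw [← integral_sum_reducedBetti_nonemptySublevel (totalCorrelation_mono hρ)
    (totalCorrelation_empty hρ) (totalCorrelation_singleton ρ) hε]
  exact (tsum_integral_reducedBetti (nonemptySublevel_mono _)
    (isRelLowerSet_nonemptySublevel (totalCorrelation_mono hρ)) 0 ε).symm

theorem reducedIECInfty_eq (hρ : IsState ρ) :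
    reducedIECInfty ρ = ∑ J, (-1) ^ J.card * totalCorrelation ρ J :=
  (tendsto_reducedIEC hρ).limUnder_eq

theorem interactionInformation_eq_sum_purity (ρ : Op n) :
    interactionInformation ρ =
      ∑ J, (-1) ^ J.card * (purity ρ J).re - ∑ J : Finset (Fin n), (-1) ^ J.card := by
  rw [interactionInformation, ← Finset.sum_sub_distrib]
  refine Finset.sum_congr rfl fun J _ => ?_
  rw [linearEntropy_eq, pow_succ]
  ring

theorem sum_neg_one_pow_card_mul_totalCorrelation (hn : n ≠ 1) (ρ : Op n) :
    ∑ J, (-1) ^ J.card * totalCorrelation ρ J = interactionInformation ρ := by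
  have hlinear := sum_neg_one_pow_card_mul_sum_eq_zero (V := Fin n) (by simpa using hn)
    fun v => linearEntropy ρ {v}
  simp only [totalCorrelation, mul_sub, Finset.sum_sub_distrib, interactionInformation, pow_succ,
    mul_neg_one, neg_mul, Finset.sum_neg_distrib]
  rw [hlinear, zero_sub]

end IntegratedEulerCharacteristic

section SpinFlip

variable {n : ℕ}

theorem localOp_mul (K L : Fin n → Matrix (Fin 2) (Fin 2) ℂ) :
    localOp K * localOp L = localOp fun j => K j * L j := by
  ext a b
  simp only [localOp, Matrix.mul_apply, Matrix.of_apply, ← Finset.prod_mul_distrib]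
  rw [Finset.prod_univ_sum, Fintype.piFinset_univ]

theorem localOp_transpose (K : Fin n → Matrix (Fin 2) (Fin 2) ℂ) :
    (localOp K)ᵀ = localOp fun j => (K j)ᵀ := rfl

theorem localOp_conjTranspose (K : Fin n → Matrix (Fin 2) (Fin 2) ℂ) :
    (localOp K)ᴴ = localOp fun j => (K j)ᴴ := by
  ext a b
  simp [localOp]

theorem localOp_one : localOp (1 : Fin n → Matrix (Fin 2) (Fin 2) ℂ) = 1 := by
  ext a b
  simp only [localOp, Matrix.of_apply, Pi.one_apply, Matrix.one_apply, Finset.prod_ite_zero,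
    Finset.prod_const_one, Finset.mem_univ, true_imp_iff, funext_iff]

theorem localOp_smul (c : Fin n → ℂ) (K : Fin n → Matrix (Fin 2) (Fin 2) ℂ) :
    (localOp fun j => c j • K j) = (∏ j, c j) • localOp K := by
  ext a b
  simp [localOp, Finset.prod_mul_distrib]

/-- The antisymmetric bilinear form on `ℂ²`, i.e. the (unnormalized) coefficient matrix of the
singlet state of two qubits. -/
def singlet : Matrix (Fin 2) (Fin 2) ℂ := !![0, 1; -1, 0]

theorem singlet_conjTranspose : singletᴴ = singletᵀ := by
  ext i j
  fin_cases i <;> fin_cases j <;> simp [singlet]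

theorem singlet_transpose_mul_self : singletᵀ * singlet = 1 := by
  ext i j
  fin_cases i <;> fin_cases j <;> simp [singlet, Matrix.mul_apply]

theorem singlet_mul_transpose_mul_transpose (A : Matrix (Fin 2) (Fin 2) ℂ) :
    singlet * Aᵀ * singletᵀ = A.adjugate := by
  ext i j
  fin_cases i <;> fin_cases j <;>
    simp [singlet, Matrix.mul_apply, Matrix.vecMul, dotProduct, Matrix.adjugate_fin_two]

theorem singlet_apply_mul_apply (a b c d : Fin 2) :
    singlet b a * singlet d c =
      -(if b = c ∧ a = d then 1 else 0) + (if a = c ∧ b = d then 1 else 0) := by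
  fin_cases a <;> fin_cases b <;> fin_cases c <;> fin_cases d <;> simp [singlet]

/-- The tensor power `singlet ⊗ ⋯ ⊗ singlet`, pairing each of `n` qubits with its copy. -/
def singletPow (n : ℕ) : Op n := localOp fun _ => singlet

theorem singletPow_conjTranspose (n : ℕ) : (singletPow n)ᴴ = (singletPow n)ᵀ := by
  simp only [singletPow, localOp_conjTranspose, localOp_transpose, singlet_conjTranspose]

theorem singletPow_transpose_mul_self (n : ℕ) : (singletPow n)ᵀ * singletPow n = 1 := by
  simp only [singletPow, localOp_transpose, localOp_mul, singlet_transpose_mul_self]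
  exact localOp_one

/-- The spin flip `A ↦ ε Aᵀ εᵀ`, where `ε` is the tensor power of the singlet form. -/
def spinFlip : Op n →ₗ[ℂ] Op n :=
  LinearMap.mulLeftRight ℂ (singletPow n, (singletPow n)ᵀ) ∘ₗ
    (Matrix.transposeLinearEquiv _ _ ℂ ℂ).toLinearMap

theorem spinFlip_apply (A : Op n) : spinFlip A = singletPow n * Aᵀ * (singletPow n)ᵀ := rfl

theorem spinFlip_one : spinFlip (1 : Op n) = 1 := by
  rw [spinFlip_apply, Matrix.transpose_one, Matrix.mul_one]
  exact mul_eq_one_comm.mp (singletPow_transpose_mul_self n)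

theorem spinFlip_mul (A B : Op n) : spinFlip (A * B) = spinFlip B * spinFlip A := by
  calc singletPow n * (A * B)ᵀ * (singletPow n)ᵀ
      = singletPow n * Bᵀ * ((singletPow n)ᵀ * singletPow n) * Aᵀ * (singletPow n)ᵀ := by
        rw [singletPow_transpose_mul_self, Matrix.mul_one, Matrix.transpose_mul,
          Matrix.mul_assoc _ Bᵀ]
    _ = _ := by simp only [spinFlip_apply, Matrix.mul_assoc]

theorem spinFlip_conjTranspose (A : Op n) : spinFlip Aᴴ = (spinFlip A)ᴴ := by
  simp only [spinFlip_apply, Matrix.conjTranspose_mul, ← singletPow_conjTranspose,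
    Matrix.conjTranspose_conjTranspose, Matrix.mul_assoc]
  rfl

theorem posSemidef_spinFlip {A : Op n} (hA : A.PosSemidef) : (spinFlip A).PosSemidef := by
  rw [spinFlip_apply, ← singletPow_conjTranspose]
  exact hA.transpose.mul_mul_conjTranspose_same _

theorem spinFlip_localOp (K : Fin n → Matrix (Fin 2) (Fin 2) ℂ) :
    spinFlip (localOp K) = localOp fun j => (K j).adjugate := by
  simp only [spinFlip_apply, singletPow, localOp_transpose, localOp_mul,
    singlet_mul_transpose_mul_transpose]

theorem spinFlip_localOp_mul_localOp (K : Fin n → Matrix (Fin 2) (Fin 2) ℂ) :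
    spinFlip (localOp K) * localOp K = (∏ j, (K j).det) • 1 := by
  rw [spinFlip_localOp, localOp_mul, ← localOp_one, ← localOp_smul]
  simp only [Matrix.adjugate_mul, Pi.one_apply]

theorem sum_neg_one_pow_card_smul_permMatrix_partialSwap :
    ∑ J : Finset (Fin n), (-1 : ℂ) ^ J.card • (partialSwap (α := Fin 2) J).permMatrix ℂ =
      Matrix.vecMulVec (singletPow n).vec (singletPow n).vec := by
  ext ⟨x, y⟩ ⟨z, w⟩
  simp only [Matrix.sum_apply, Matrix.smul_apply, Matrix.vecMulVec_apply, Matrix.vec, singletPow,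
    localOp, Matrix.of_apply, ← Finset.prod_mul_distrib, singlet_apply_mul_apply]
  rw [Finset.prod_add, Finset.powerset_univ]
  refine Finset.sum_congr rfl fun J _ => ?_
  rw [Finset.prod_neg, mul_assoc, Finset.prod_ite_zero, Finset.prod_ite_zero,
    ite_zero_mul_ite_zero]
  simp only [Finset.prod_const_one, mul_one, smul_eq_mul]
  congr 1
  refine if_congr ?_ rfl rfl
  simp only [Finset.mem_univ, Finset.mem_sdiff, true_and, Equiv.toPEquiv_apply,
    Option.mem_some_iff, partialSwap_apply, Prod.mk.injEq, funext_iff, Finset.piecewise]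
  grind

end SpinFlip

section FlipOverlap

variable {n : ℕ}

/-- The overlap `Tr ρ ρ̃` of an operator with its spin flip. -/
def flipOverlap (ρ : Op n) : ℂ :=
  (ρ * spinFlip ρ).trace

theorem flipOverlap_nonneg {ρ : Op n} (hρ : ρ.PosSemidef) : 0 ≤ flipOverlap ρ :=
  trace_mul_nonneg hρ (posSemidef_spinFlip hρ)

theorem flipOverlap_smul (c : ℂ) (ρ : Op n) : flipOverlap (c • ρ) = c ^ 2 * flipOverlap ρ := by
  rw [flipOverlap, map_smul, smul_mul_smul_comm, Matrix.trace_smul, smul_eq_mul, sq]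
  rfl

theorem flipOverlap_mul_mul_conjTranspose {K : Op n} {d : ℂ} (hK : spinFlip K * K = d • 1)
    (ρ : Op n) : flipOverlap (K * ρ * Kᴴ) = (‖d‖ ^ 2 : ℝ) * flipOverlap ρ := by
  have hK' : Kᴴ * spinFlip Kᴴ = star d • 1 := by
    rw [spinFlip_conjTranspose, ← Matrix.conjTranspose_mul, hK, Matrix.conjTranspose_smul,
      Matrix.conjTranspose_one]
  calc flipOverlap (K * ρ * Kᴴ)
      = (K * ρ * (Kᴴ * spinFlip Kᴴ) * spinFlip ρ * spinFlip K).trace := by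
        simp only [flipOverlap, spinFlip_mul, Matrix.mul_assoc]
    _ = (spinFlip K * K * ρ * (Kᴴ * spinFlip Kᴴ) * spinFlip ρ).trace := by
        rw [Matrix.trace_mul_comm]
        simp only [Matrix.mul_assoc]
    _ = (‖d‖ ^ 2 : ℝ) * flipOverlap ρ := by
        rw [hK, hK', flipOverlap]
        simp only [Matrix.smul_mul, Matrix.mul_smul, Matrix.one_mul, Matrix.mul_one,
          Matrix.trace_smul, smul_eq_mul, ← mul_assoc]
        rw [← Complex.normSq_eq_norm_sq, Complex.normSq_eq_conj_mul_self]
        rfl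

theorem sum_neg_one_pow_card_mul_purity (ρ : Op n) :
    ∑ J, (-1) ^ J.card * purity ρ J = flipOverlap ρ := by
  let ε := singletPow n
  calc ∑ J, (-1) ^ J.card * purity ρ J
      = ((ρ ⊗ₖ ρ) * Matrix.vecMulVec ε.vec ε.vec).trace := by
        rw [← sum_neg_one_pow_card_smul_permMatrix_partialSwap, Matrix.mul_sum, Matrix.trace_sum]
        simp only [Matrix.mul_smul, Matrix.trace_smul, smul_eq_mul,
          purity_eq_trace_kronecker_mul_partialSwap]
    _ = (ρ * ε * ρᵀ).vec ⬝ᵥ ε.vec := by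
        rw [Matrix.mul_vecMulVec, Matrix.trace_vecMulVec, Matrix.kronecker_mulVec_vec]
    _ = flipOverlap ρ := by
        rw [dotProduct_comm, Matrix.vec_dotProduct_vec, Matrix.trace_mul_comm, flipOverlap,
          spinFlip_apply]
        simp only [ε, Matrix.mul_assoc]

theorem interactionInformation_eq (ρ : Op n) :
    interactionInformation ρ = (flipOverlap ρ).re - ∑ J : Finset (Fin n), (-1) ^ J.card := by
  have hre (k : ℕ) (z : ℂ) : ((-1) ^ k * z).re = (-1) ^ k * z.re := by
    exact_mod_cast Complex.re_ofReal_mul ((-1) ^ k) z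
  rw [interactionInformation_eq_sum_purity, ← sum_neg_one_pow_card_mul_purity, Complex.re_sum]
  simp only [hre]

end FlipOverlap

section Monotone

variable {n : ℕ} {ρ : Op n}

theorem outcomeProb_nonneg (K : Op n) (hρ : ρ.PosSemidef) : 0 ≤ outcomeProb K ρ :=
  (Complex.le_def.mp (hρ.mul_mul_conjTranspose_same K).trace_nonneg).1

theorem trace_eq_outcomeProb (K : Op n) (hρ : ρ.PosSemidef) :
    (K * ρ * Kᴴ).trace = outcomeProb K ρ :=
  Complex.ext rfl (Complex.le_def.mp (hρ.mul_mul_conjTranspose_same K).trace_nonneg).2.symm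

theorem isState_postState {K : Op n} (hρ : IsState ρ) (hp : outcomeProb K ρ ≠ 0) :
    IsState (postState K ρ) := by
  refine ⟨(hρ.1.mul_mul_conjTranspose_same K).smul ?_, ?_⟩
  · exact_mod_cast inv_nonneg.mpr (outcomeProb_nonneg K hρ.1)
  · rw [postState, Matrix.trace_smul, trace_eq_outcomeProb K hρ.1, smul_eq_mul,
      inv_mul_cancel₀ (Complex.ofReal_ne_zero.mpr hp)]

theorem sum_outcomeProb {ι : Type*} [Fintype ι] (hρ : IsState ρ) {K : ι → Op n}
    (hK : ∑ i, (K i)ᴴ * K i = 1) : ∑ i, outcomeProb (K i) ρ = 1 := by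
  have hcycle : ∀ i, outcomeProb (K i) ρ = ((K i)ᴴ * K i * ρ).trace.re := fun i => by
    rw [outcomeProb, Matrix.trace_mul_comm, ← Matrix.mul_assoc]
  simp_rw [hcycle]
  rw [← Complex.re_sum, ← Matrix.trace_sum, ← Matrix.sum_mul, hK, Matrix.one_mul, hρ.2,
    Complex.one_re]

theorem norm_sq_le_outcomeProb_mul_outcomeProb (hρ : IsState ρ) {K L : Op n} {d : ℂ}
    (hLK : L * K = d • 1) : ‖d‖ ^ 2 ≤ outcomeProb K ρ * outcomeProb Lᴴ ρ := by
  have htrace : (K * ρ * Lᴴᴴ).trace = d := by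
    rw [Matrix.conjTranspose_conjTranspose, Matrix.trace_mul_comm, ← Matrix.mul_assoc, hLK,
      Matrix.smul_mul, Matrix.one_mul, Matrix.trace_smul, hρ.2, smul_eq_mul, mul_one]
  exact htrace ▸ norm_trace_mul_mul_conjTranspose_sq_le hρ.1 K Lᴴ

theorem outcomeProb_mul_flipOverlap_postState_le (hρ : IsState ρ) {K : Op n} {d : ℂ}
    (hK : spinFlip K * K = d • 1) :
    outcomeProb K ρ * (flipOverlap (postState K ρ)).re ≤
      outcomeProb (spinFlip Kᴴ) ρ * (flipOverlap ρ).re := by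
  have hCauchySchwarz := norm_sq_le_outcomeProb_mul_outcomeProb hρ hK
  rw [← spinFlip_conjTranspose] at hCauchySchwarz
  have hpost : outcomeProb K ρ * (flipOverlap (postState K ρ)).re =
      ‖d‖ ^ 2 / outcomeProb K ρ * (flipOverlap ρ).re := by
    rw [postState, flipOverlap_smul, flipOverlap_mul_mul_conjTranspose hK, ← Complex.ofReal_inv,
      ← Complex.ofReal_pow, Complex.re_ofReal_mul, Complex.re_ofReal_mul]
    field_simp
  rw [hpost]
  refine mul_le_mul_of_nonneg_right ?_ (Complex.le_def.mp (flipOverlap_nonneg hρ.1)).1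
  exact div_le_of_le_mul₀ (outcomeProb_nonneg K hρ.1) (outcomeProb_nonneg _ hρ.1)
    (hCauchySchwarz.trans_eq (mul_comm _ _))

theorem sum_spinFlip_conjTranspose {ι : Type*} [Fintype ι] {K : ι → Op n}
    (hK : ∑ i, (K i)ᴴ * K i = 1) : ∑ i, (spinFlip (K i)ᴴ)ᴴ * spinFlip (K i)ᴴ = 1 := by
  have hterm : ∀ i, (spinFlip (K i)ᴴ)ᴴ * spinFlip (K i)ᴴ = spinFlip ((K i)ᴴ * K i) := fun i => by
    rw [← spinFlip_conjTranspose, Matrix.conjTranspose_conjTranspose, spinFlip_mul]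
  simp_rw [hterm]
  rw [← map_sum, hK, spinFlip_one]

theorem isEntanglementMonotone_flipOverlap :
    IsEntanglementMonotone fun ρ : Op n => (flipOverlap ρ).re := by
  intro ρ hρ m K hK
  calc ∑ i, outcomeProb (localOp (K i)) ρ * (flipOverlap (postState (localOp (K i)) ρ)).re
      ≤ ∑ i, outcomeProb (spinFlip (localOp (K i))ᴴ) ρ * (flipOverlap ρ).re :=
        Finset.sum_le_sum fun i _ =>
          outcomeProb_mul_flipOverlap_postState_le hρ (spinFlip_localOp_mul_localOp (K i))
    _ = (flipOverlap ρ).re := by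
        rw [← Finset.sum_mul, sum_outcomeProb hρ (sum_spinFlip_conjTranspose hK), one_mul]

theorem IsEntanglementMonotone.sub_const {T : Op n → ℝ} (hT : IsEntanglementMonotone T) (c : ℝ) :
    IsEntanglementMonotone fun ρ => T ρ - c := by
  intro ρ hρ m K hK
  simp only [mul_sub, Finset.sum_sub_distrib, ← Finset.sum_mul, sum_outcomeProb hρ hK, one_mul]
  exact sub_le_sub_right (hT ρ hρ m K hK) c

theorem IsEntanglementMonotone.congr {T U : Op n → ℝ} (hT : IsEntanglementMonotone T)
    (hTU : ∀ ρ, IsState ρ → T ρ = U ρ) : IsEntanglementMonotone U := by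
  intro ρ hρ m K hK
  have hterm : ∀ i, outcomeProb (localOp (K i)) ρ * U (postState (localOp (K i)) ρ) =
      outcomeProb (localOp (K i)) ρ * T (postState (localOp (K i)) ρ) := fun i => by
    rcases eq_or_ne (outcomeProb (localOp (K i)) ρ) 0 with hp | hp
    · simp only [hp, zero_mul]
    · rw [hTU _ (isState_postState hρ hp)]
  simp only [hterm, ← hTU ρ hρ]
  exact hT ρ hρ m K hK

theorem isEntanglementMonotone_interactionInformation :
    IsEntanglementMonotone (interactionInformation : Op n → ℝ) :=
  (isEntanglementMonotone_flipOverlap.sub_const _).congr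
    fun ρ _ => (interactionInformation_eq ρ).symm

end Monotone
end QubitPersistence

open QubitPersistence in
theorem mainTheorem5_general (n : ℕ) (hn : n ≠ 1) :
    (∀ ρ : Op n, IsState ρ →
      (∀ ε : ℝ, IsRelLowerSet (sublevelComplex ρ ε) Finset.Nonempty) ∧
      Filter.Tendsto (reducedIEC ρ) Filter.atTop (𝓝 (reducedIECInfty ρ)) ∧
      reducedIECInfty ρ = interactionInformation ρ) ∧
    IsEntanglementMonotone (reducedIECInfty : Op n → ℝ) := by
  have hinfty : ∀ ρ : Op n, IsState ρ → reducedIECInfty ρ = interactionInformation ρ :=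
    fun ρ hρ => (reducedIECInfty_eq hρ).trans (sum_neg_one_pow_card_mul_totalCorrelation hn ρ)
  refine ⟨fun ρ hρ => ⟨isRelLowerSet_sublevelComplex hρ, ?_, hinfty ρ hρ⟩,
    isEntanglementMonotone_interactionInformation.congr fun ρ hρ => (hinfty ρ hρ).symm⟩
  rw [reducedIECInfty_eq hρ]
  exact tendsto_reducedIEC hρ

theorem mainTheorem5 (n : ℕ) (hn : Even n) :
    (∀ ρ : QubitPersistence.Op n, QubitPersistence.IsState ρ →
      (∀ ε : ℝ, IsRelLowerSet (QubitPersistence.sublevelComplex ρ ε) Finset.Nonempty) ∧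
      Filter.Tendsto (QubitPersistence.reducedIEC ρ) Filter.atTop
        (𝓝 (QubitPersistence.reducedIECInfty ρ)) ∧
      QubitPersistence.reducedIECInfty ρ = QubitPersistence.interactionInformation ρ) ∧
    QubitPersistence.IsEntanglementMonotone
      (QubitPersistence.reducedIECInfty : QubitPersistence.Op n → ℝ) :=
  mainTheorem5_general n fun h => Nat.not_even_one (h ▸ hn)
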